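/- Consider Bell tests with $n$ parties, where party $j$ receives an input bit $s_j$ and returns an output bit $m_j$; the correlator vector of conditional probabilities $p(\mathbf m|\mathbf s)$ is $p(1|\mathbf s)=\sum_{\mathbf m:\,m_1\oplus\cdots\oplus m_n=1}p(\mathbf m|\mathbf s)$, $\mathbf s\in\{0,1\}^n$. It is a local hidden variable (LHV) correlator if $p(\mathbf m|\mathbf s)=\sum_{g_1,\dots,g_n}p_{g_1,\dots,g_n}\prod_j\delta^{m_j}_{g_j(s_j)}$, a convex combination over maps $g_j:\{0,1\}\to\{0,1\}$. It is a quantum correlator if $p(\mathbf m|\mathbf s)=\mathrm{Tr}\big(\rho\bigotimes_{j=1}^nP^{s_j}_{m_j}\big)$ for some complex Hilbert spaces $\mathcal H_1,\dots,\mathcal H_n$ of arbitrary (possibly infinite) dimension, a density matrix $\rho$ on $\bigotimes_j\mathcal H_j$, and for each party $j$ and input $s_j$ a two-outcome POVM $\{P^{s_j}_{0},P^{s_j}_{1}\}$ on $\mathcal H_j$. Let $f(\mathbf s)=s_1s_2\cdots s_n\oplus1$ be the $n$-partite NAND function. For every $n\ge3$, the inequality $$\frac1{2^n}\sum_{\mathbf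 s\in\{0,1\}^n}(-1)^{f(\mathbf s)+1}\,p(1|\mathbf s)\;\le\;\frac{2^n-2}{2^n}$$ is a non-trivial Bell inequality, that is, its right-hand side is the maximum of the left-hand side over all LHV correlators, while some vector $\big(p(1|\mathbf s)\big)_{\mathbf s}$ with entries in $[0,1]$ violates it; and it is not violated by quantum correlators: every quantum correlator satisfies it. -/

import Mathlib

universe u

noncomputable section

open scoped InnerProductSpace TensorProduct ComplexOrder ComplexConjugate

namespace Bell

/-! ### The Hilbert space tensor product of a finite family of complex Hilbert spaces

The algebraic tensor product carries the positive semidefinite Hermitian form determined by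
`⟪⨂ x_j, ⨂ y_j⟫ = ∏ ⟪x_j, y_j⟫`; the Hilbert space tensor product is the completion. -/

section Hilbert

variable {ι : Type} (H : ι → Type u) [∀ j, NormedAddCommGroup (H j)]
  [∀ j, InnerProductSpace ℂ (H j)]

/-- The algebraic tensor product `⨂ H_j` (a type synonym, which does not inherit the projective
seminorm from Mathlib). -/
def AlgTensor : Type _ := ⨂[ℂ] j, H j

instance : AddCommGroup (AlgTensor H) := inferInstanceAs (AddCommGroup (⨂[ℂ] j, H j))

instance : Module ℂ (AlgTensor H) := inferInstanceAs (Module ℂ (⨂[ℂ] j, H j))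

/-- Elementary tensors in the algebraic tensor product. -/
def AlgTensor.tprod : MultilinearMap ℂ H (AlgTensor H) := PiTensorProduct.tprod ℂ

variable {H}

theorem AlgTensor.exists_rep (u : AlgTensor H) :
    ∃ (κ : Type) (_ : Fintype κ) (c : κ → ℂ) (x : κ → ∀ j, H j),
      u = ∑ k, c k • AlgTensor.tprod H (x k) := by
  refine PiTensorProduct.induction_on u ?_ ?_
  · intro r f
    exact ⟨Unit, inferInstance, fun _ => r, fun _ => f,
      (Fintype.sum_unique fun _ : Unit => r • AlgTensor.tprod H f).symm⟩
  · rintro _ _ ⟨κ, _, c, x, rfl⟩ ⟨κ', _, c', x', rfl⟩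
    exact ⟨κ ⊕ κ', inferInstance, Sum.elim c c', Sum.elim x x',
      (Fintype.sum_sum_type fun k => Sum.elim c c' k • AlgTensor.tprod H (Sum.elim x x' k)).symm⟩

/-- The algebraic tensor product of bounded operators, `⨂ x_j ↦ ⨂ A_j x_j`. -/
def AlgTensor.map (A : ∀ j, H j →L[ℂ] H j) : AlgTensor H →ₗ[ℂ] AlgTensor H :=
  PiTensorProduct.map fun j => (A j).toLinearMap

theorem AlgTensor.map_tprod (A : ∀ j, H j →L[ℂ] H j) (x : ∀ j, H j) :
    AlgTensor.map A (AlgTensor.tprod H x) = AlgTensor.tprod H fun j => A j (x j) :=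
  PiTensorProduct.map_tprod _ x

/-- Monotonicity of entrywise products of positive semidefinite matrices. -/
theorem posSemidef_prod_sub {κ : Type} [Fintype κ] (S : Finset ι) (A B : ι → Matrix κ κ ℂ)
    (hA : ∀ j, (A j).PosSemidef) (hAB : ∀ j, (B j - A j).PosSemidef) :
    (Matrix.of fun k l => ∏ j ∈ S, A j k l).PosSemidef ∧
      (Matrix.of fun k l => ∏ j ∈ S, B j k l - ∏ j ∈ S, A j k l).PosSemidef := by
  classical
  induction S using Finset.induction_on with
  | empty =>
    constructor
    · have e : (Matrix.of fun k l => ∏ j ∈ (∅ : Finset ι), A j k l) =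
          Matrix.gram ℂ (fun _ : κ => (1 : ℂ)) := by
        ext k l
        simp
      rw [e]
      exact Matrix.posSemidef_gram ℂ _
    · have e : (Matrix.of fun k l => ∏ j ∈ (∅ : Finset ι), B j k l -
          ∏ j ∈ (∅ : Finset ι), A j k l) = 0 := by
        ext k l
        simp
      rw [e]
      exact Matrix.PosSemidef.zero
  | insert i S hi ih =>
    obtain ⟨h1, h2⟩ := ih
    constructor
    · have e : (Matrix.of fun k l => ∏ j ∈ insert i S, A j k l) =
          (A i).hadamard (Matrix.of fun k l => ∏ j ∈ S, A j k l) := by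
        ext k l
        simp [Finset.prod_insert hi]
      rw [e]
      exact (hA i).hadamard h1
    · have hB : (B i).PosSemidef := by simpa using (hAB i).add (hA i)
      have e : (Matrix.of fun k l => ∏ j ∈ insert i S, B j k l - ∏ j ∈ insert i S, A j k l) =
          (B i).hadamard (Matrix.of fun k l => ∏ j ∈ S, B j k l - ∏ j ∈ S, A j k l) +
            (B i - A i).hadamard (Matrix.of fun k l => ∏ j ∈ S, A j k l) := by
        ext k l
        simp [Finset.prod_insert hi]
        ring
      rw [e]
      exact (hB.hadamard h2).add ((hAB i).hadamard h1)

theorem quadForm_nonneg {κ : Type} [Fintype κ] {M : Matrix κ κ ℂ} (hM : M.PosSemidef)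
    (c : κ → ℂ) : 0 ≤ ∑ k, ∑ l, conj (c k) * c l * M k l := by
  have h := hM.dotProduct_mulVec_nonneg c
  convert h using 1
  simp only [dotProduct, Matrix.mulVec, Pi.star_apply, Finset.mul_sum, RCLike.star_def]
  exact Finset.sum_congr rfl fun k _ => Finset.sum_congr rfl fun l _ => by ring

variable [Fintype ι]

/-- The linear functional `⨂ y_j ↦ ∏ ⟪x_j, y_j⟫`. -/
def AlgTensor.pairLeft (x : ∀ j, H j) : AlgTensor H →ₗ[ℂ] ℂ :=
  PiTensorProduct.lift ((MultilinearMap.mkPiAlgebra ℂ ι ℂ).compLinearMap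
    (fun j => (innerSL ℂ (x j)).toLinearMap))

theorem AlgTensor.pairLeft_tprod (x y : ∀ j, H j) :
    AlgTensor.pairLeft x (AlgTensor.tprod H y) = ∏ j, ⟪x j, y j⟫_ℂ := by
  exact (PiTensorProduct.lift.tprod y).trans (by simp)

theorem AlgTensor.pairLeft_conj (x y : ∀ j, H j) :
    conj (AlgTensor.pairLeft x (AlgTensor.tprod H y)) =
      AlgTensor.pairLeft y (AlgTensor.tprod H x) := by
  simp [AlgTensor.pairLeft_tprod, map_prod]

/-- The linear functional `⨂ x_j ↦ conj ⟪⨂ x_j, t⟫ = ⟪t, ⨂ x_j⟫`. -/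
def AlgTensor.pairRight (t : AlgTensor H) : AlgTensor H →ₗ[ℂ] ℂ :=
  PiTensorProduct.lift
    { toFun := fun x => conj (AlgTensor.pairLeft x t)
      map_update_add' := by
        intro _ x i a b
        obtain ⟨κ, _, c, y, rfl⟩ := AlgTensor.exists_rep t
        simp only [map_sum, map_smul, smul_eq_mul, map_mul, AlgTensor.pairLeft_conj,
          MultilinearMap.map_update_add, map_add, mul_add, Finset.sum_add_distrib]
      map_update_smul' := by
        intro _ x i r a
        obtain ⟨κ, _, c, y, rfl⟩ := AlgTensor.exists_rep t
        simp only [map_sum, map_smul, smul_eq_mul, map_mul, AlgTensor.pairLeft_conj,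
          MultilinearMap.map_update_smul, Finset.mul_sum]
        exact Finset.sum_congr rfl fun k _ => by ring }

theorem AlgTensor.pairRight_tprod (t : AlgTensor H) (x : ∀ j, H j) :
    AlgTensor.pairRight t (AlgTensor.tprod H x) = conj (AlgTensor.pairLeft x t) :=
  PiTensorProduct.lift.tprod x

/-- The Hermitian form on the algebraic tensor product, conjugate linear in the first variable. -/
def AlgTensor.form (u t : AlgTensor H) : ℂ := conj (AlgTensor.pairRight t u)

theorem AlgTensor.form_sum {κ κ' : Type} [Fintype κ] [Fintype κ'] (c : κ → ℂ)
    (x : κ → ∀ j, H j) (d : κ' → ℂ) (y : κ' → ∀ j, H j) :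
    AlgTensor.form (∑ k, c k • AlgTensor.tprod H (x k)) (∑ l, d l • AlgTensor.tprod H (y l)) =
      ∑ k, ∑ l, conj (c k) * d l * ∏ j, ⟪x k j, y l j⟫_ℂ := by
  simp only [AlgTensor.form, map_sum, map_smul, smul_eq_mul, map_mul, AlgTensor.pairRight_tprod,
    Complex.conj_conj, AlgTensor.pairLeft_tprod, Finset.mul_sum, mul_assoc]

theorem AlgTensor.form_tprod (x y : ∀ j, H j) :
    AlgTensor.form (AlgTensor.tprod H x) (AlgTensor.tprod H y) = ∏ j, ⟪x j, y j⟫_ℂ := by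
  simp [AlgTensor.form, AlgTensor.pairRight_tprod, AlgTensor.pairLeft_tprod]

variable (H) in
/-- The Hermitian form makes the algebraic tensor product a pre-Hilbert space. -/
@[reducible]
def AlgTensor.core : PreInnerProductSpace.Core ℂ (AlgTensor H) where
  inner := AlgTensor.form
  conj_inner_symm u t := by
    obtain ⟨κ, _, c, x, rfl⟩ := AlgTensor.exists_rep u
    obtain ⟨κ', _, d, y, rfl⟩ := AlgTensor.exists_rep t
    simp only [AlgTensor.form_sum, map_sum, map_mul, map_prod, inner_conj_symm, Complex.conj_conj]
    rw [Finset.sum_comm]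
    exact Finset.sum_congr rfl fun k _ => Finset.sum_congr rfl fun l _ => by ring
  re_inner_nonneg u := by
    obtain ⟨κ, _, c, x, rfl⟩ := AlgTensor.exists_rep u
    rw [AlgTensor.form_sum]
    have h := (posSemidef_prod_sub Finset.univ (fun j => Matrix.gram ℂ fun k => x k j)
      (fun j => Matrix.gram ℂ fun k => x k j) (fun j => Matrix.posSemidef_gram ℂ _)
      (fun j => by simpa using Matrix.PosSemidef.zero)).1
    exact (Complex.le_def.1 (quadForm_nonneg h c)).1
  add_left u t z := by simp [AlgTensor.form]
  smul_left u t r := by simp [AlgTensor.form]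

instance : SeminormedAddCommGroup (AlgTensor H) :=
  @InnerProductSpace.Core.toSeminormedAddCommGroup ℂ (AlgTensor H) _ _ _ (AlgTensor.core H)

instance : InnerProductSpace ℂ (AlgTensor H) := InnerProductSpace.ofCore (AlgTensor.core H)

theorem AlgTensor.inner_eq (u t : AlgTensor H) : ⟪u, t⟫_ℂ = AlgTensor.form u t := rfl

theorem AlgTensor.norm_map_le (A : ∀ j, H j →L[ℂ] H j) (u : AlgTensor H) :
    ‖AlgTensor.map A u‖ ≤ (∏ j, ‖A j‖) * ‖u‖ := by
  obtain ⟨κ, _, c, x, rfl⟩ := AlgTensor.exists_rep u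
  have hG : ∀ j, ((Matrix.of fun k l => ((‖A j‖ ^ 2 : ℝ) : ℂ) * ⟪x k j, x l j⟫_ℂ) -
      Matrix.gram ℂ fun k => A j (x k j) : Matrix κ κ ℂ).PosSemidef := by
    intro j
    refine Matrix.PosSemidef.of_dotProduct_mulVec_nonneg ?_ fun d => ?_
    · ext k l
      simp only [Matrix.conjTranspose_apply, Matrix.sub_apply, Matrix.of_apply, Matrix.gram_apply,
        star_sub, star_mul', RCLike.star_def, Complex.conj_ofReal, inner_conj_symm]
    · have e : star d ⬝ᵥ ((Matrix.of fun k l => ((‖A j‖ ^ 2 : ℝ) : ℂ) * ⟪x k j, x l j⟫_ℂ) -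
          Matrix.gram ℂ fun k => A j (x k j) : Matrix κ κ ℂ).mulVec d =
          ((‖A j‖ ^ 2 * ‖∑ k, d k • x k j‖ ^ 2 - ‖A j (∑ k, d k • x k j)‖ ^ 2 : ℝ) : ℂ) := by
        have e1 := Matrix.star_dotProduct_gram_mulVec (𝕜 := ℂ) (fun k => x k j) d d
        have e2 := Matrix.star_dotProduct_gram_mulVec (𝕜 := ℂ) (fun k => A j (x k j)) d d
        have e3 : (Matrix.of fun k l => ((‖A j‖ ^ 2 : ℝ) : ℂ) * ⟪x k j, x l j⟫_ℂ) =
            ((‖A j‖ ^ 2 : ℝ) : ℂ) • Matrix.gram ℂ (fun k => x k j) := by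
          ext k l
          simp
        rw [e3, Matrix.sub_mulVec, dotProduct_sub, e2, Matrix.smul_mulVec, dotProduct_smul, e1,
          inner_self_eq_norm_sq_to_K, inner_self_eq_norm_sq_to_K, map_sum]
        simp
      rw [e, Complex.zero_le_real, sub_nonneg, ← mul_pow]
      exact pow_le_pow_left₀ (norm_nonneg _) ((A j).le_opNorm _) 2
  have hP := quadForm_nonneg (posSemidef_prod_sub Finset.univ
    (fun j => Matrix.gram ℂ fun k => A j (x k j)) _ (fun j => Matrix.posSemidef_gram ℂ _) hG).2 c
  have h1 : ∀ v : AlgTensor H, ‖v‖ ^ 2 = (AlgTensor.form v v).re := fun v =>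
    (InnerProductSpace.norm_sq_eq_re_inner (𝕜 := ℂ) v)
  refine abs_le_of_sq_le_sq' ?_ (by positivity) |>.2
  rw [mul_pow, h1, h1]
  simp only [map_sum, map_smul, AlgTensor.map_tprod]
  rw [AlgTensor.form_sum, AlgTensor.form_sum]
  have e : (∑ k, ∑ l, conj (c k) * c l * (Matrix.of fun k l =>
      ∏ j, (Matrix.of fun k l => ((‖A j‖ ^ 2 : ℝ) : ℂ) * ⟪x k j, x l j⟫_ℂ) k l -
        ∏ j, (Matrix.gram ℂ fun k => A j (x k j)) k l) k l) =
      (((∏ j, ‖A j‖) ^ 2 : ℝ) : ℂ) * (∑ k, ∑ l, conj (c k) * c l * ∏ j, ⟪x k j, x l j⟫_ℂ) -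
        ∑ k, ∑ l, conj (c k) * c l * ∏ j, ⟪A j (x k j), A j (x l j)⟫_ℂ := by
    simp only [Finset.mul_sum, ← Finset.sum_sub_distrib]
    refine Finset.sum_congr rfl fun k _ => Finset.sum_congr rfl fun l _ => ?_
    simp only [Matrix.of_apply, Matrix.gram_apply, Finset.prod_mul_distrib]
    push_cast
    rw [Finset.prod_pow]
    ring
  rw [e] at hP
  have hre := (Complex.le_def.1 hP).1
  rw [Complex.sub_re, Complex.re_ofReal_mul] at hre
  simpa using hre

/-- The Hilbert space tensor product `⨂ H_j`. -/
abbrev HilbertTensor (H : ι → Type u) [∀ j, NormedAddCommGroup (H j)]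
    [∀ j, InnerProductSpace ℂ (H j)] : Type _ := UniformSpace.Completion (AlgTensor H)

/-- The elementary tensor `⨂ x_j` in the Hilbert space tensor product. -/
def HilbertTensor.tprod (x : ∀ j, H j) : HilbertTensor H := (AlgTensor.tprod H x : AlgTensor H)

/-- The algebraic tensor product of bounded operators, as a bounded operator. -/
def AlgTensor.mapL (A : ∀ j, H j →L[ℂ] H j) : AlgTensor H →L[ℂ] AlgTensor H :=
  (AlgTensor.map A).mkContinuous _ (AlgTensor.norm_map_le A)

/-- The bounded operator `⨂ A_j` on the Hilbert space tensor product: the continuous extension of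
`⨂ x_j ↦ ⨂ A_j x_j`. -/
def HilbertTensor.map (A : ∀ j, H j →L[ℂ] H j) : HilbertTensor H →L[ℂ] HilbertTensor H :=
  (UniformSpace.Completion.toComplL.comp (AlgTensor.mapL A)).extend
    UniformSpace.Completion.toComplL

theorem HilbertTensor.map_coe (A : ∀ j, H j →L[ℂ] H j) (u : AlgTensor H) :
    HilbertTensor.map A (u : HilbertTensor H) = (AlgTensor.map A u : AlgTensor H) := by
  have h := ContinuousLinearMap.extend_eq
    (UniformSpace.Completion.toComplL.comp (AlgTensor.mapL A) : AlgTensor H →L[ℂ] HilbertTensor H)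
    (e := (UniformSpace.Completion.toComplL : AlgTensor H →L[ℂ] HilbertTensor H))
    UniformSpace.Completion.denseRange_coe
    (UniformSpace.Completion.isUniformInducing_coe _) u
  exact h

theorem HilbertTensor.map_tprod (A : ∀ j, H j →L[ℂ] H j) (x : ∀ j, H j) :
    HilbertTensor.map A (HilbertTensor.tprod x) = HilbertTensor.tprod fun j => A j (x j) := by
  rw [HilbertTensor.tprod, HilbertTensor.map_coe, AlgTensor.map_tprod, HilbertTensor.tprod]

theorem HilbertTensor.inner_tprod (x y : ∀ j, H j) :
    ⟪HilbertTensor.tprod x, HilbertTensor.tprod y⟫_ℂ = ∏ j, ⟪x j, y j⟫_ℂ := by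
  rw [HilbertTensor.tprod, HilbertTensor.tprod, UniformSpace.Completion.inner_coe,
    AlgTensor.inner_eq, AlgTensor.form_tprod]

end Hilbert

/-! ### States and measurements -/

/-- A density matrix `ρ = ∑ p_l |ψ_l⟩⟨ψ_l|` on a Hilbert space, given as a countable convex
combination of pure states (unit vectors). -/
structure DensityMatrix (K : Type u) [NormedAddCommGroup K] [InnerProductSpace ℂ K] where
  /-- the probabilities `p_l` -/
  weight : ℕ → ℝ
  /-- the state vectors `ψ_l` -/
  vec : ℕ → K
  weight_nonneg : ∀ l, 0 ≤ weight l
  hasSum_weight : HasSum weight 1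
  norm_vec : ∀ l, ‖vec l‖ = 1

/-- `Tr (ρ T) = ∑ p_l ⟨ψ_l| T |ψ_l⟩`. -/
def DensityMatrix.traceMul {K : Type u} [NormedAddCommGroup K] [InnerProductSpace ℂ K]
    (ρ : DensityMatrix K) (T : K →L[ℂ] K) : ℂ :=
  ∑' l, (ρ.weight l : ℂ) * ⟪ρ.vec l, T (ρ.vec l)⟫_ℂ

/-- A positive operator valued measure with the two outcomes `0`, `1`. -/
structure POVM (K : Type u) [NormedAddCommGroup K] [InnerProductSpace ℂ K] where
  /-- the element `P_m` associated with the outcome `m` -/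
  effect : ZMod 2 → K →L[ℂ] K
  effect_pos : ∀ m, (effect m).IsPositive
  sum_effect : ∑ m, effect m = 1

/-! ### Correlators for `n` parties, each with two inputs and two outputs -/

/-- Bit-strings of length `n`. -/
abbrev Bits (n : ℕ) : Type := Fin n → ZMod 2

/-- The correlator vector `s ↦ p(1|s) = ∑_{m : m_1 ⊕ ⋯ ⊕ m_n = 1} p(m|s)` of a table of conditional
probabilities `p m s = p(m|s)`. -/
def correlator {n : ℕ} (p : Bits n → Bits n → ℝ) : Bits n → ℝ :=
  fun s => ∑ m with ∑ j, m j = 1, p m s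

/-- Conditional probabilities arising from local hidden variables: a convex combination of
deterministic local response functions `g_j`. -/
def IsLHV {n : ℕ} (p : Bits n → Bits n → ℝ) : Prop :=
  ∃ w : (Fin n → ZMod 2 → ZMod 2) → ℝ, (∀ g, 0 ≤ w g) ∧ ∑ g, w g = 1 ∧
    ∀ m s, p m s = ∑ g, w g * ∏ j, if m j = g j (s j) then 1 else 0

/-- Conditional probabilities arising in quantum theory: `p(m|s) = Tr (ρ ⨂ P^{s_j}_{m_j})` for a
density matrix `ρ` on a tensor product of Hilbert spaces of arbitrary (possibly infinite) dimension,
one for each party, and POVMs `P^{s_j}` for the inputs of each party. -/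
def IsQuantum {n : ℕ} (p : Bits n → Bits n → ℝ) : Prop :=
  ∃ (H : Fin n → Type u) (_ : ∀ j, NormedAddCommGroup (H j))
    (_ : ∀ j, InnerProductSpace ℂ (H j)) (_ : ∀ j, CompleteSpace (H j))
    (ρ : DensityMatrix (HilbertTensor H)) (P : ∀ j, ZMod 2 → POVM (H j)),
    ∀ m s, (p m s : ℂ) = ρ.traceMul (HilbertTensor.map fun j => (P j (s j)).effect (m j))

/-- The space `𝓟` of all possible correlators. -/
def allCorrelators (n : ℕ) : Set (Bits n → ℝ) := {x | ∀ s, 0 ≤ x s ∧ x s ≤ 1}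

/-- The space `𝓛` of local hidden variable correlators. -/
def lhvCorrelators (n : ℕ) : Set (Bits n → ℝ) := {x | ∃ p, IsLHV p ∧ x = correlator p}

/-- The space `𝓠` of quantum correlators. -/
def quantumCorrelators (n : ℕ) : Set (Bits n → ℝ) := {x | ∃ p, IsQuantum.{u} p ∧ x = correlator p}

/-- The Bell expression `∑_s β_s p(1|s)`. -/
def bellExpression {n : ℕ} (β x : Bits n → ℝ) : ℝ := ∑ s, β s * x s

/-- `∑_s β_s p(1|s) ≤ γ` is a Bell inequality: `γ` is the tight upper bound over all local hidden
variable correlators. -/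
def IsBellInequality {n : ℕ} (β : Bits n → ℝ) (γ : ℝ) : Prop :=
  IsGreatest (bellExpression β '' lhvCorrelators n) γ

/-- A Bell inequality is non-trivial if some correlator in the space of all correlators
violates it. -/
def IsNontrivialBellInequality {n : ℕ} (β : Bits n → ℝ) (γ : ℝ) : Prop :=
  IsBellInequality β γ ∧ ∃ x ∈ allCorrelators n, γ < bellExpression β x

/-- The `n`-partite NAND function `s_1 s_2 ⋯ s_n ⊕ 1`. -/
def nand {n : ℕ} (s : Bits n) : ZMod 2 := ∏ j, s j + 1

/-- The coefficients `2⁻ⁿ (-1)^{f(s)+1}` for the NAND function `f` and uniform input weights. -/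
def nandCoeff (n : ℕ) (s : Bits n) : ℝ := 1 / 2 ^ n * (-1) ^ ((nand s).val + 1)

end Bell

end

/-!
With `E(s)` the expectation of the product of the `±1`-valued outcomes, the Bell expression is an
affine function of `∑ₛ E(s) - 2 E(1⋯1)`, so everything rests on
`|∑ₛ E(s) - 2 E(1⋯1)| ≤ 2ⁿ - 2`. If party `j` measures the observables `A_j` and `B_j` on the inputs
`0` and `1`, multilinearity turns the left-hand side into the expectation of
`⨂ (A_j + B_j) - 2 ⨂ B_j`, and it suffices to bound the norm of this operator. Each tensor product
is a product of `n` operators, one on each factor, and splitting off one of them,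
`(A + B) S - 2 B T = A S + B (S - 2 T)`, adds at most `2ⁿ` to the bound for `n` factors, so that
`2ⁿ - 2` becomes `2ⁿ⁺¹ - 2`. The induction starts at three factors: there the operator applied to
a unit vector has norm at most `p + q`, where the parallelogram law gives `p² + 2 q² ≤ 24`, whence
`p + q ≤ 6` by the Cauchy-Schwarz inequality. For two factors the bound fails, since the maximal
CHSH violation gives `2 √2 > 2`.

Deterministic local strategies are quantum strategies on one-dimensional Hilbert spaces, so by
convexity the same bound holds for local hidden variables; it is attained when one party always
answers `1` and all the others always answer `0`.
-/

noncomputable section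

open scoped InnerProductSpace

namespace Bell

section Contractions

theorem norm_add_sq_add_two_mul_norm_add_sq_le (𝕜 : Type*) {E : Type*} [RCLike 𝕜]
    [SeminormedAddCommGroup E] [InnerProductSpace 𝕜 E] (x y z : E) :
    ‖x + y‖ ^ 2 + 2 * ‖x + z‖ ^ 2 ≤ 4 * ‖x‖ ^ 2 + ‖y‖ ^ 2 + 2 * ‖z‖ ^ 2 + ‖y + 2 • z‖ ^ 2 := by
  have h := sq_nonneg ‖x - (y + 2 • z)‖
  simp only [two_nsmul, norm_add_sq (𝕜 := 𝕜), norm_sub_sq (𝕜 := 𝕜), inner_add_right,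
    map_add] at h ⊢
  linarith

theorem five_mul_norm_add_sq_add_two_mul_norm_sub_sq (𝕜 : Type*) {E : Type*} [RCLike 𝕜]
    [SeminormedAddCommGroup E] [InnerProductSpace 𝕜 E] (a b : E) :
    5 * ‖a + b‖ ^ 2 + 2 * ‖a - b‖ ^ 2 + ‖a + b + 2 • (a - b)‖ ^ 2 =
      16 * ‖a‖ ^ 2 + 8 * ‖b‖ ^ 2 := by
  have h : a + b + 2 • (a - b) = a + a + (a - b) := by module
  simp only [h, norm_add_sq (𝕜 := 𝕜), norm_sub_sq (𝕜 := 𝕜), inner_add_left, inner_sub_right,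
    map_add, map_sub, inner_self_eq_norm_sq]
  ring

variable {𝕜 E κ : Type*} [RCLike 𝕜] [SeminormedAddCommGroup E] [InnerProductSpace 𝕜 E]

theorem norm_add_add_norm_add_le_six_mul {C D : E →L[𝕜] E} (hC : ‖C‖ ≤ 1) (hD : ‖D‖ ≤ 1)
    {a b : E} {r : ℝ} (ha : ‖a‖ ≤ r) (hb : ‖b‖ ≤ r) :
    ‖C (a + b) + D (a + b)‖ + ‖C (a + b) + D (a - b)‖ ≤ 6 * r := by
  have hsq {T : E →L[𝕜] E} (hT : ‖T‖ ≤ 1) (x : E) : ‖T x‖ ^ 2 ≤ ‖x‖ ^ 2 := by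
    gcongr
    exact (T.le_of_opNorm_le hT x).trans_eq (one_mul _)
  set p := ‖C (a + b) + D (a + b)‖
  set q := ‖C (a + b) + D (a - b)‖
  have hr : 0 ≤ r := (norm_nonneg a).trans ha
  have hpq : p ^ 2 + 2 * q ^ 2 ≤ 24 * r ^ 2 := calc
    p ^ 2 + 2 * q ^ 2
      ≤ 4 * ‖C (a + b)‖ ^ 2 + ‖D (a + b)‖ ^ 2 + 2 * ‖D (a - b)‖ ^ 2 +
          ‖D (a + b + 2 • (a - b))‖ ^ 2 := by
        rw [map_add D (a + b) (_ • _), map_nsmul]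
        exact norm_add_sq_add_two_mul_norm_add_sq_le 𝕜 _ _ _
    _ ≤ 4 * ‖a + b‖ ^ 2 + ‖a + b‖ ^ 2 + 2 * ‖a - b‖ ^ 2 + ‖a + b + 2 • (a - b)‖ ^ 2 := by
        gcongr 4 * ?_ + ?_ + 2 * ?_ + ?_
        exacts [hsq hC _, hsq hD _, hsq hD _, hsq hD _]
    _ = 16 * ‖a‖ ^ 2 + 8 * ‖b‖ ^ 2 := by
        rw [← five_mul_norm_add_sq_add_two_mul_norm_sub_sq 𝕜]
        ring
    _ ≤ 16 * r ^ 2 + 8 * r ^ 2 := by gcongr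
    _ = 24 * r ^ 2 := by ring
  refine abs_le_of_sq_le_sq' ?_ (by positivity) |>.2
  linarith [sq_nonneg (p - 2 * q)]

theorem norm_mul_add_sub_two_nsmul_le_six {A₁ A₂ A₃ B₁ B₂ B₃ : E →L[𝕜] E}
    (hA₁ : ‖A₁‖ ≤ 1) (hA₂ : ‖A₂‖ ≤ 1) (hA₃ : ‖A₃‖ ≤ 1)
    (hB₁ : ‖B₁‖ ≤ 1) (hB₂ : ‖B₂‖ ≤ 1) (hB₃ : ‖B₃‖ ≤ 1) :
    ‖(A₁ + B₁) * ((A₂ + B₂) * (A₃ + B₃)) - 2 • (B₁ * (B₂ * B₃))‖ ≤ 6 := by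
  have hle {T : E →L[𝕜] E} (hT : ‖T‖ ≤ 1) (x : E) : ‖T x‖ ≤ ‖x‖ :=
    (T.le_of_opNorm_le hT x).trans_eq (one_mul _)
  refine ContinuousLinearMap.opNorm_le_bound _ (by norm_num) fun φ => ?_
  have hsplit : ((A₁ + B₁) * ((A₂ + B₂) * (A₃ + B₃)) - 2 • (B₁ * (B₂ * B₃))) φ =
      A₁ (A₂ (A₃ φ + B₃ φ) + B₂ (A₃ φ + B₃ φ)) +
        B₁ (A₂ (A₃ φ + B₃ φ) + B₂ (A₃ φ - B₃ φ)) := by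
    simp only [sub_apply, smul_apply, mul_apply_eq_comp, add_apply, map_add, map_sub]
    module
  rw [hsplit]
  exact (norm_add_le_of_le (hle hA₁ _) (hle hB₁ _)).trans
    (norm_add_add_norm_add_le_six_mul hA₂ hB₂ (hle hA₃ φ) (hle hB₃ φ))

variable {A B : κ → E →L[𝕜] E}

theorem norm_prod_map_add_le_two_pow (hA : ∀ i, ‖A i‖ ≤ 1) (hB : ∀ i, ‖B i‖ ≤ 1) (l : List κ) :
    ‖(l.map fun i => A i + B i).prod‖ ≤ 2 ^ l.length := by
  induction l with
  | nil => exact ContinuousLinearMap.norm_id_le.trans_eq (pow_zero 2).symm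
  | cons i l ih =>
    rw [List.map_cons, List.prod_cons, List.length_cons, pow_succ']
    exact norm_mul_le_of_le ((norm_add_le_of_le (hA i) (hB i)).trans_eq one_add_one_eq_two) ih

theorem norm_prod_map_add_sub_two_nsmul_le (hA : ∀ i, ‖A i‖ ≤ 1) (hB : ∀ i, ‖B i‖ ≤ 1) :
    ∀ {l : List κ}, 3 ≤ l.length →
      ‖(l.map fun i => A i + B i).prod - 2 • (l.map B).prod‖ ≤ 2 ^ l.length - 2
  | [i, j, k], _ => by
    have h := norm_mul_add_sub_two_nsmul_le_six (hA i) (hA j) (hA k) (hB i) (hB j) (hB k)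
    have hsix : (2 : ℝ) ^ [i, j, k].length - 2 = 6 := by norm_num
    rw [hsix]
    simpa only [List.map_cons, List.map_nil, List.prod_cons, List.prod_nil, mul_one] using h
  | i :: j :: k :: m :: l, _ => by
    generalize ht : j :: k :: m :: l = t
    have ih := norm_prod_map_add_sub_two_nsmul_le hA hB (l := t) (by simp [← ht])
    simp only [List.map_cons, List.prod_cons, List.length_cons]
    set S := (t.map fun i => A i + B i).prod
    calc ‖(A i + B i) * S - 2 • (B i * (t.map B).prod)‖
        = ‖A i * S + B i * (S - 2 • (t.map B).prod)‖ := by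
          rw [add_mul, mul_sub, mul_smul_comm, add_sub_assoc]
      _ ≤ 1 * 2 ^ t.length + 1 * (2 ^ t.length - 2) :=
          norm_add_le_of_le (norm_mul_le_of_le (hA i) (norm_prod_map_add_le_two_pow hA hB t))
            (norm_mul_le_of_le (hB i) ih)
      _ = 2 ^ (t.length + 1) - 2 := by ring

end Contractions

theorem prod_map_mulSingle_toList {ι : Type*} [Fintype ι] [DecidableEq ι] {M : ι → Type*}
    [∀ i, Monoid (M i)] (x : ∀ i, M i) :
    (Finset.univ.toList.map fun i => Pi.mulSingle i (x i)).prod = x := by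
  rw [← Finset.noncommProd_toFinset _ _ (fun i _ j _ _ => Pi.mulSingle_apply_commute x i j)
    (Finset.nodup_toList _)]
  simp only [Finset.toList_toFinset, Finset.noncommProd_mulSingle]

namespace HilbertTensor

variable {ι : Type} [Fintype ι] {H : ι → Type u} [∀ j, NormedAddCommGroup (H j)]
  [∀ j, InnerProductSpace ℂ (H j)]

theorem norm_tprod (x : ∀ j, H j) : ‖tprod x‖ = ∏ j, ‖x j‖ := by
  refine (sq_eq_sq₀ (norm_nonneg _) (by positivity)).1 ?_
  have h := inner_tprod x x
  simp only [inner_self_eq_norm_sq_to_K, Finset.prod_pow] at h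
  exact_mod_cast h

variable (H) in
/-- The multilinear map `(x_j) ↦ ⨂ x_j`. -/
def tprodMultilinear : MultilinearMap ℂ H (HilbertTensor H) :=
  (UniformSpace.Completion.toComplL (𝕜 := ℂ)).toLinearMap.compMultilinearMap (AlgTensor.tprod H)

theorem tprodMultilinear_apply (x : ∀ j, H j) : tprodMultilinear H x = tprod x := rfl

theorem ext_tprod {S T : HilbertTensor H →L[ℂ] HilbertTensor H}
    (h : ∀ x : ∀ j, H j, S (tprod x) = T (tprod x)) : S = T := by
  ext v
  induction v using UniformSpace.Completion.induction_on with
  | hp => exact isClosed_eq S.continuous T.continuous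
  | ih u =>
    obtain ⟨κ, _, c, x, rfl⟩ := AlgTensor.exists_rep u
    rw [← UniformSpace.Completion.coe_toComplL (𝕜 := ℂ)]
    simp only [map_sum, map_smul]
    exact Finset.sum_congr rfl fun k _ => congrArg (c k • ·) (h (x k))

theorem map_update_tprod [DecidableEq ι] (A : ∀ j, H j →L[ℂ] H j) (j : ι) (S : H j →L[ℂ] H j)
    (x : ∀ j, H j) : map (Function.update A j S) (tprod x) =
      tprodMultilinear H (Function.update (fun i => A i (x i)) j (S (x j))) := by
  rw [map_tprod, tprodMultilinear_apply]
  congr 1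
  ext i
  exact Function.apply_update (fun i (T : H i →L[ℂ] H i) => T (x i)) A j S i

variable (H) in
/-- The multilinear map `(A_j) ↦ ⨂ A_j` on bounded operators. -/
def mapMultilinear :
    MultilinearMap ℂ (fun j => H j →L[ℂ] H j) (HilbertTensor H →L[ℂ] HilbertTensor H) where
  toFun := map
  map_update_add' A j S T := ext_tprod fun x => by
    simp only [add_apply, map_update_tprod, MultilinearMap.map_update_add]
  map_update_smul' A j c S := ext_tprod fun x => by
    simp only [smul_apply, map_update_tprod, MultilinearMap.map_update_smul]

variable (H) in
/-- The monoid homomorphism `(A_j) ↦ ⨂ A_j` on bounded operators. -/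
def mapMonoidHom : (∀ j, H j →L[ℂ] H j) →* (HilbertTensor H →L[ℂ] HilbertTensor H) where
  toFun := map
  map_one' := ext_tprod fun x => map_tprod 1 x
  map_mul' A B := ext_tprod fun x => by
    simp only [mul_apply_eq_comp, map_tprod, Pi.mul_apply]

theorem map_sum_eq_sum_map [DecidableEq ι] {κ : Type*} [Fintype κ] (T : ∀ j, κ → H j →L[ℂ] H j) :
    map (fun j => ∑ k, T j k) = ∑ f : ι → κ, map fun j => T j (f j) :=
  (mapMultilinear H).map_sum T

theorem map_smul_eq_prod_smul (c : ι → ℂ) (A : ∀ j, H j →L[ℂ] H j) :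
    map (fun j => c j • A j) = (∏ j, c j) • map A :=
  (mapMultilinear H).map_smul_univ c A

theorem norm_map_le (A : ∀ j, H j →L[ℂ] H j) : ‖map A‖ ≤ ∏ j, ‖A j‖ := by
  refine ContinuousLinearMap.opNorm_le_bound _ (by positivity) fun v => ?_
  induction v using UniformSpace.Completion.induction_on with
  | hp => exact isClosed_le (by fun_prop) (by fun_prop)
  | ih u =>
    rw [map_coe, UniformSpace.Completion.norm_coe, UniformSpace.Completion.norm_coe]
    exact AlgTensor.norm_map_le A u

theorem norm_map_mulSingle_le_one [DecidableEq ι] {j : ι} {T : H j →L[ℂ] H j} (hT : ‖T‖ ≤ 1) :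
    ‖map (Pi.mulSingle j T)‖ ≤ 1 := by
  refine (norm_map_le _).trans (Finset.prod_le_one (fun _ _ => norm_nonneg _) fun i _ => ?_)
  rcases eq_or_ne i j with rfl | hij
  · rwa [Pi.mulSingle_eq_same]
  · rw [Pi.mulSingle_eq_of_ne hij]
    exact ContinuousLinearMap.norm_id_le

theorem map_eq_prod_map_mulSingle [DecidableEq ι] (A : ∀ j, H j →L[ℂ] H j) :
    map A = (Finset.univ.toList.map fun j => map (Pi.mulSingle j (A j))).prod := calc
  map A = mapMonoidHom H (Finset.univ.toList.map fun j => Pi.mulSingle j (A j)).prod :=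
    congrArg map (prod_map_mulSingle_toList A).symm
  _ = (Finset.univ.toList.map fun j => map (Pi.mulSingle j (A j))).prod := by
    rw [map_list_prod, List.map_map]
    rfl

theorem map_mulSingle_add [DecidableEq ι] (j : ι) (S T : H j →L[ℂ] H j) :
    map (Pi.mulSingle j (S + T)) = map (Pi.mulSingle j S) + map (Pi.mulSingle j T) :=
  (mapMultilinear H).map_update_add 1 j S T

theorem norm_map_add_sub_two_nsmul_map_le {A B : ∀ j, H j →L[ℂ] H j} (hA : ∀ j, ‖A j‖ ≤ 1)
    (hB : ∀ j, ‖B j‖ ≤ 1) (hι : 3 ≤ Fintype.card ι) :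
    ‖map (fun j => A j + B j) - 2 • map B‖ ≤ 2 ^ Fintype.card ι - 2 := by
  classical
  have hlen : Finset.univ.toList.length = Fintype.card ι := Finset.length_toList _
  rw [map_eq_prod_map_mulSingle fun j => A j + B j, map_eq_prod_map_mulSingle B, ← hlen]
  simp only [map_mulSingle_add]
  exact norm_prod_map_add_sub_two_nsmul_le (fun j => norm_map_mulSingle_le_one (hA j))
    (fun j => norm_map_mulSingle_le_one (hB j)) (hlen ▸ hι)

end HilbertTensor

section StatesAndMeasurements

variable {K : Type u} [NormedAddCommGroup K] [InnerProductSpace ℂ K]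

namespace DensityMatrix

theorem norm_weight_mul_inner_le (ρ : DensityMatrix K) (T : K →L[ℂ] K) (l : ℕ) :
    ‖(ρ.weight l : ℂ) * ⟪ρ.vec l, T (ρ.vec l)⟫_ℂ‖ ≤ ρ.weight l * ‖T‖ := by
  have hT : ‖T (ρ.vec l)‖ ≤ ‖T‖ := T.unit_le_opNorm _ (ρ.norm_vec l).le
  have hin : ‖⟪ρ.vec l, T (ρ.vec l)⟫_ℂ‖ ≤ ‖T‖ := calc
    ‖⟪ρ.vec l, T (ρ.vec l)⟫_ℂ‖ ≤ ‖ρ.vec l‖ * ‖T (ρ.vec l)‖ := norm_inner_le_norm _ _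
    _ ≤ ‖T‖ := by rwa [ρ.norm_vec, one_mul]
  rw [norm_mul, Complex.norm_of_nonneg (ρ.weight_nonneg l)]
  exact mul_le_mul_of_nonneg_left hin (ρ.weight_nonneg l)

theorem hasSum_traceMul (ρ : DensityMatrix K) (T : K →L[ℂ] K) :
    HasSum (fun l => (ρ.weight l : ℂ) * ⟪ρ.vec l, T (ρ.vec l)⟫_ℂ) (ρ.traceMul T) :=
  (ρ.hasSum_weight.summable.mul_right ‖T‖).of_norm_bounded (ρ.norm_weight_mul_inner_le T) |>.hasSum

theorem norm_traceMul_le (ρ : DensityMatrix K) (T : K →L[ℂ] K) : ‖ρ.traceMul T‖ ≤ ‖T‖ :=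
  (tsum_of_norm_bounded (ρ.hasSum_weight.mul_right ‖T‖) (ρ.norm_weight_mul_inner_le T)).trans_eq
    (one_mul _)

theorem traceMul_one (ρ : DensityMatrix K) : ρ.traceMul 1 = 1 := by
  have h := Complex.hasSum_ofReal.2 ρ.hasSum_weight
  refine (ρ.hasSum_traceMul 1).unique ?_
  simpa [inner_self_eq_norm_sq_to_K, ρ.norm_vec] using h

/-- The functional `T ↦ Tr (ρ T)` as a linear map. -/
def traceMulLinear (ρ : DensityMatrix K) : (K →L[ℂ] K) →ₗ[ℂ] ℂ where
  toFun := ρ.traceMul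
  map_add' S T := (ρ.hasSum_traceMul (S + T)).unique <| by
    simpa only [add_apply, inner_add_right, mul_add] using
      (ρ.hasSum_traceMul S).add (ρ.hasSum_traceMul T)
  map_smul' c T := (ρ.hasSum_traceMul (c • T)).unique <| by
    simpa only [smul_apply, inner_smul_right, mul_left_comm, RingHom.id_apply, smul_eq_mul] using
      (ρ.hasSum_traceMul T).mul_left c

theorem traceMulLinear_apply (ρ : DensityMatrix K) (T : K →L[ℂ] K) :
    ρ.traceMulLinear T = ρ.traceMul T := rfl

/-- The pure state `|ψ⟩⟨ψ|` of a unit vector `ψ`. -/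
def pure (ψ : K) (hψ : ‖ψ‖ = 1) : DensityMatrix K where
  weight l := if l = 0 then 1 else 0
  vec _ := ψ
  weight_nonneg l := by split_ifs <;> norm_num
  hasSum_weight := hasSum_ite_eq 0 1
  norm_vec _ := hψ

theorem traceMul_pure {ψ : K} (hψ : ‖ψ‖ = 1) (T : K →L[ℂ] K) :
    (pure ψ hψ).traceMul T = ⟪ψ, T ψ⟫_ℂ := by
  simp [traceMul, pure, apply_ite Complex.ofReal]

end DensityMatrix

theorem sum_zmod_two {M : Type*} [AddCommMonoid M] (f : ZMod 2 → M) : ∑ a, f a = f 0 + f 1 :=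
  Fin.sum_univ_two f

namespace POVM

/-- The `±1`-valued observable `P₀ - P₁` of a two-outcome measurement. -/
def observable (P : POVM K) : K →L[ℂ] K := P.effect 0 - P.effect 1

theorem effect_zero_add_effect_one (P : POVM K) : P.effect 0 + P.effect 1 = 1 :=
  (sum_zmod_two _).symm.trans P.sum_effect

theorem abs_reApplyInnerSelf_observable_le (P : POVM K) (x : K) :
    |P.observable.reApplyInnerSelf x| ≤ ‖x‖ ^ 2 := by
  have h₀ : 0 ≤ (P.effect 0).reApplyInnerSelf x := (P.effect_pos 0).re_inner_nonneg_left x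
  have h₁ : 0 ≤ (P.effect 1).reApplyInnerSelf x := (P.effect_pos 1).re_inner_nonneg_left x
  have hsum : (P.effect 0).reApplyInnerSelf x + (P.effect 1).reApplyInnerSelf x = ‖x‖ ^ 2 := by
    have h := congrArg (fun T : K →L[ℂ] K => T.reApplyInnerSelf x) P.effect_zero_add_effect_one
    simpa [ContinuousLinearMap.reApplyInnerSelf_apply, inner_add_left, ← Complex.ofReal_pow] using h
  have hdiff : P.observable.reApplyInnerSelf x =
      (P.effect 0).reApplyInnerSelf x - (P.effect 1).reApplyInnerSelf x := by
    simp only [observable, ContinuousLinearMap.reApplyInnerSelf_apply, sub_apply, inner_sub_left,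
      map_sub]
  rw [hdiff, abs_le]
  constructor <;> linarith

theorem norm_observable_le_one (P : POVM K) : ‖P.observable‖ ≤ 1 := by
  have hsymm : P.observable.IsSymmetric :=
    (P.effect_pos 0).isSymmetric.sub (P.effect_pos 1).isSymmetric
  rw [ContinuousLinearMap.norm_eq_iSup_rayleighQuotient _ hsymm]
  refine Real.iSup_le (fun x => ?_) zero_le_one
  rw [ContinuousLinearMap.rayleighQuotient, abs_div, abs_of_nonneg (sq_nonneg ‖x‖)]
  exact div_le_one_of_le₀ (P.abs_reApplyInnerSelf_observable_le x) (sq_nonneg _)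

variable (K) in
/-- The measurement that returns the outcome `b` in every state. -/
def certain (b : ZMod 2) : POVM K where
  effect m := if m = b then 1 else 0
  effect_pos m := by
    split_ifs
    exacts [ContinuousLinearMap.isPositive_one, ContinuousLinearMap.isPositive_zero]
  sum_effect := by rw [Finset.sum_ite_eq' Finset.univ b, if_pos (Finset.mem_univ b)]

end POVM

end StatesAndMeasurements

section Correlators

/-- The character `a ↦ (-1)^a` of `ℤ/2`. -/
def bitSign : AddChar (ZMod 2) ℝ := AddChar.zmodChar 2 (ζ := -1) (by norm_num)

theorem bitSign_one : bitSign 1 = -1 := by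
  rw [bitSign, AddChar.zmodChar_apply, ZMod.val_one, pow_one]

theorem bitSign_sum {ι : Type*} [Fintype ι] (m : ι → ZMod 2) :
    bitSign (∑ j, m j) = ∏ j, bitSign (m j) :=
  map_prod bitSign.toMonoidHom (fun j => Multiplicative.ofAdd (m j)) Finset.univ

theorem one_sub_bitSign_div_two (a : ZMod 2) : (1 - bitSign a) / 2 = if a = 1 then 1 else 0 := by
  obtain rfl | rfl : a = 0 ∨ a = 1 := by decide +revert
  · norm_num [AddChar.map_zero_eq_one]
  · norm_num [bitSign_one]

theorem POVM.sum_bitSign_smul_effect {K : Type u} [NormedAddCommGroup K] [InnerProductSpace ℂ K]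
    (P : POVM K) : ∑ a, (bitSign a : ℂ) • P.effect a = P.observable := by
  rw [sum_zmod_two, AddChar.map_zero_eq_one, bitSign_one, POVM.observable]
  push_cast
  module

variable {n : ℕ}

/-- The expectation value `E(s) = ∑ₘ (-1)^(m₁ ⊕ ⋯ ⊕ mₙ) p(m|s)` of the product of the `±1`-valued
outcomes. -/
def expectation (p : Bits n → Bits n → ℝ) (s : Bits n) : ℝ := ∑ m, bitSign (∑ j, m j) * p m s

theorem correlator_eq_sum_sub_expectation_div_two (p : Bits n → Bits n → ℝ) (s : Bits n) :
    correlator p s = (∑ m, p m s - expectation p s) / 2 := by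
  rw [correlator, expectation, ← Finset.sum_sub_distrib, Finset.sum_div, Finset.sum_filter]
  refine Finset.sum_congr rfl fun m _ => ?_
  calc (if ∑ j, m j = 1 then p m s else 0)
      = (1 - bitSign (∑ j, m j)) / 2 * p m s := by
        rw [one_sub_bitSign_div_two, ite_mul, one_mul, zero_mul]
    _ = (p m s - bitSign (∑ j, m j) * p m s) / 2 := by ring

theorem nandCoeff_eq (s : Bits n) : nandCoeff n s = (1 - if s = 1 then 2 else 0) / 2 ^ n := by
  split_ifs with hs
  · have h : nand s = 0 := by
      rw [nand, hs]
      exact (congrArg (· + 1) Finset.prod_const_one).trans (CharTwo.add_self_eq_zero 1)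
    rw [nandCoeff, h, ZMod.val_zero]
    ring
  · obtain ⟨j, hj⟩ : ∃ j, s j ≠ 1 := Function.ne_iff.1 hs
    have hj₀ : s j = 0 := not_not.1 ((Fin.eq_one_of_ne_zero (s j)).mt hj)
    have h : nand s = 1 := by rw [nand, Finset.prod_eq_zero (Finset.mem_univ j) hj₀, zero_add]
    rw [nandCoeff, h, ZMod.val_one]
    ring

theorem bellExpression_nandCoeff (x : Bits n → ℝ) :
    bellExpression (nandCoeff n) x = (∑ s, x s - 2 * x 1) / 2 ^ n := by
  simp only [bellExpression, nandCoeff_eq, div_mul_eq_mul_div, ← Finset.sum_div, sub_mul, one_mul,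
    ite_mul, zero_mul, Finset.sum_sub_distrib, Finset.sum_ite_eq', Finset.mem_univ, if_true]

theorem bellExpression_nandCoeff_correlator {p : Bits n → Bits n → ℝ}
    (hp : ∀ s, ∑ m, p m s = 1) :
    bellExpression (nandCoeff n) (correlator p) =
      (2 ^ n - 2 - (∑ s, expectation p s - 2 * expectation p 1)) / 2 / 2 ^ n := by
  simp only [bellExpression_nandCoeff, correlator_eq_sum_sub_expectation_div_two, hp,
    ← Finset.sum_div, Finset.sum_sub_distrib, Finset.sum_const, Finset.card_univ, Fintype.card_pi,
    ZMod.card, Finset.prod_const, Fintype.card_fin, nsmul_eq_mul, mul_one]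
  push_cast
  ring

end Correlators

section Quantum

variable {ι : Type} [Fintype ι] {H : ι → Type u} [∀ j, NormedAddCommGroup (H j)]
  [∀ j, InnerProductSpace ℂ (H j)]

theorem DensityMatrix.sum_prod_mul_traceMul_map_effect [DecidableEq ι]
    (ρ : DensityMatrix (HilbertTensor H)) (P : ∀ j, POVM (H j)) (c : ZMod 2 → ℂ) :
    ∑ m : ι → ZMod 2,
        (∏ j, c (m j)) * ρ.traceMul (HilbertTensor.map fun j => (P j).effect (m j)) =
      ρ.traceMul (HilbertTensor.map fun j => ∑ a, c a • (P j).effect a) := by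
  simp only [← traceMulLinear_apply, HilbertTensor.map_sum_eq_sum_map,
    HilbertTensor.map_smul_eq_prod_smul, map_sum, map_smul, smul_eq_mul]

variable {n : ℕ} {H : Fin n → Type u} [∀ j, NormedAddCommGroup (H j)]
  [∀ j, InnerProductSpace ℂ (H j)]

/-- Born's rule `p(m|s) = Tr (ρ ⨂ P^{s_j}_{m_j})` for a fixed state `ρ` and fixed local
measurements `P`. -/
def SatisfiesBornRule (p : Bits n → Bits n → ℝ) (ρ : DensityMatrix (HilbertTensor H))
    (P : ∀ j, ZMod 2 → POVM (H j)) : Prop :=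
  ∀ m s, (p m s : ℂ) = ρ.traceMul (HilbertTensor.map fun j => (P j (s j)).effect (m j))

namespace SatisfiesBornRule

variable {p : Bits n → Bits n → ℝ} {ρ : DensityMatrix (HilbertTensor H)}
  {P : ∀ j, ZMod 2 → POVM (H j)}

theorem sum_eq_one (hp : SatisfiesBornRule p ρ P) (s : Bits n) : ∑ m, p m s = 1 := by
  have h := ρ.sum_prod_mul_traceMul_map_effect (fun j => P j (s j)) 1
  simp only [Pi.one_apply, Finset.prod_const_one, one_mul, one_smul, POVM.sum_effect, ← hp _ s] at h
  have hone : HilbertTensor.map (fun j => (1 : H j →L[ℂ] H j)) = 1 :=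
    (HilbertTensor.mapMonoidHom H).map_one
  rw [hone, DensityMatrix.traceMul_one] at h
  exact_mod_cast h

theorem expectation_eq_traceMul (hp : SatisfiesBornRule p ρ P) (s : Bits n) :
    (expectation p s : ℂ) = ρ.traceMul (HilbertTensor.map fun j => (P j (s j)).observable) := by
  have h := ρ.sum_prod_mul_traceMul_map_effect (fun j => P j (s j)) fun a => (bitSign a : ℂ)
  simp only [← hp _ s, POVM.sum_bitSign_smul_effect] at h
  simp only [← h, expectation, bitSign_sum, Complex.ofReal_sum, Complex.ofReal_mul,
    Complex.ofReal_prod]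

theorem sum_expectation_sub_eq_traceMul (hp : SatisfiesBornRule p ρ P) :
    ((∑ s, expectation p s - 2 * expectation p 1 : ℝ) : ℂ) =
      ρ.traceMul (HilbertTensor.map (fun j => (P j 0).observable + (P j 1).observable) -
        2 • HilbertTensor.map fun j => (P j 1).observable) := by
  have hsum : HilbertTensor.map (fun j => (P j 0).observable + (P j 1).observable) =
      ∑ s : Bits n, HilbertTensor.map fun j => (P j (s j)).observable := by
    simp only [← HilbertTensor.map_sum_eq_sum_map (fun j a => (P j a).observable), sum_zmod_two]
  rw [hsum, ← DensityMatrix.traceMulLinear_apply, map_sub, map_sum, map_nsmul]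
  simp only [DensityMatrix.traceMulLinear_apply, Complex.ofReal_sub, Complex.ofReal_sum,
    Complex.ofReal_mul, hp.expectation_eq_traceMul, Pi.one_apply, Complex.ofReal_ofNat,
    nsmul_eq_mul, Nat.cast_ofNat]

end SatisfiesBornRule

theorem IsQuantum.bellExpression_nandCoeff_le {p : Bits n → Bits n → ℝ} (hn : 3 ≤ n)
    (hp : IsQuantum.{u} p) :
    bellExpression (nandCoeff n) (correlator p) ≤ (2 ^ n - 2) / 2 ^ n := by
  obtain ⟨H, _, _, _, ρ, P, hp⟩ := hp
  change SatisfiesBornRule p ρ P at hp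
  have hE : |∑ s, expectation p s - 2 * expectation p 1| ≤ 2 ^ n - 2 := by
    rw [← Real.norm_eq_abs, ← Complex.norm_real, hp.sum_expectation_sub_eq_traceMul]
    refine (ρ.norm_traceMul_le _).trans ?_
    simpa using HilbertTensor.norm_map_add_sub_two_nsmul_map_le
      (fun j => (P j 0).norm_observable_le_one) (fun j => (P j 1).norm_observable_le_one)
      (by simpa using hn)
  rw [bellExpression_nandCoeff_correlator hp.sum_eq_one]
  gcongr
  linarith [neg_le_of_abs_le hE]

end Quantum

section LocalHiddenVariables

variable {n : ℕ}

/-- The conditional probabilities of the deterministic local strategy in which party `j` answers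
the input `a` by `g j a`. -/
def deterministic (g : Fin n → ZMod 2 → ZMod 2) (m s : Bits n) : ℝ :=
  ∏ j, if m j = g j (s j) then 1 else 0

theorem deterministic_eq_ite (g : Fin n → ZMod 2 → ZMod 2) (m s : Bits n) :
    deterministic g m s = if m = fun j => g j (s j) then 1 else 0 := by
  simp only [deterministic, Finset.prod_ite_zero, Finset.mem_univ, forall_true_left,
    Finset.prod_const_one, funext_iff]

theorem correlator_deterministic (g : Fin n → ZMod 2 → ZMod 2) (s : Bits n) :
    correlator (deterministic g) s = if ∑ j, g j (s j) = 1 then 1 else 0 := by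
  simp only [correlator, deterministic_eq_ite, Finset.sum_ite_eq', Finset.mem_filter,
    Finset.mem_univ, true_and]

theorem isLHV_deterministic (g : Fin n → ZMod 2 → ZMod 2) : IsLHV (deterministic g) := by
  refine ⟨fun g' => if g' = g then 1 else 0, fun g' => by positivity, ?_, fun m s => ?_⟩
  · rw [Finset.sum_ite_eq', if_pos (Finset.mem_univ g)]
  · simp only [ite_mul, one_mul, zero_mul, Finset.sum_ite_eq', Finset.mem_univ, if_true,
      deterministic]

theorem isQuantum_deterministic (g : Fin n → ZMod 2 → ZMod 2) :
    IsQuantum.{0} (deterministic g) := by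
  have hψ : ‖HilbertTensor.tprod fun _ : Fin n => (1 : ℂ)‖ = 1 := by
    rw [HilbertTensor.norm_tprod, Finset.prod_eq_one fun _ _ => norm_one]
  refine ⟨fun _ => ℂ, inferInstance, inferInstance, inferInstance, .pure _ hψ,
    fun j a => .certain ℂ (g j a), fun m s => ?_⟩
  rw [DensityMatrix.traceMul_pure, HilbertTensor.map_tprod, HilbertTensor.inner_tprod,
    deterministic, Complex.ofReal_prod]
  refine Finset.prod_congr rfl fun j _ => ?_
  by_cases h : m j = g j (s j) <;> simp [POVM.certain, h]

theorem IsLHV.bellExpression_correlator_le {p : Bits n → Bits n → ℝ} (hp : IsLHV p)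
    {β : Bits n → ℝ} {γ : ℝ} (h : ∀ g, bellExpression β (correlator (deterministic g)) ≤ γ) :
    bellExpression β (correlator p) ≤ γ := by
  obtain ⟨w, hw, hw₁, hp⟩ := hp
  have hcorr : correlator p = ∑ g, w g • correlator (deterministic g) := by
    ext s
    simp only [correlator, hp, Finset.sum_apply, Pi.smul_apply, smul_eq_mul, Finset.mul_sum,
      deterministic]
    exact Finset.sum_comm
  calc bellExpression β (correlator p)
      = ∑ g, w g * bellExpression β (correlator (deterministic g)) := by
        simp only [hcorr, bellExpression, Finset.sum_apply, Pi.smul_apply, smul_eq_mul,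
          Finset.mul_sum, mul_left_comm]
        exact Finset.sum_comm
    _ ≤ ∑ g, w g * γ := by
        gcongr with g
        exacts [hw g, h g]
    _ = γ := by rw [← Finset.sum_mul, hw₁, one_mul]

theorem one_mem_lhvCorrelators [NeZero n] : 1 ∈ lhvCorrelators n := by
  refine ⟨deterministic fun j _ => (Pi.single 0 1 : Bits n) j, isLHV_deterministic _, ?_⟩
  ext s
  rw [correlator_deterministic, Finset.sum_pi_single', if_pos (Finset.mem_univ _), if_pos rfl,
    Pi.one_apply]

theorem bellExpression_nandCoeff_one :
    bellExpression (nandCoeff n) 1 = (2 ^ n - 2) / 2 ^ n := by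
  simp [bellExpression_nandCoeff]

theorem isBellInequality_nandCoeff (hn : 3 ≤ n) :
    IsBellInequality (nandCoeff n) ((2 ^ n - 2) / 2 ^ n) := by
  have : NeZero n := ⟨by omega⟩
  refine ⟨⟨1, one_mem_lhvCorrelators, bellExpression_nandCoeff_one⟩, ?_⟩
  rintro _ ⟨_, ⟨p, hp, rfl⟩, rfl⟩
  exact hp.bellExpression_correlator_le fun g =>
    (isQuantum_deterministic g).bellExpression_nandCoeff_le hn

theorem exists_allCorrelators_lt_bellExpression_nandCoeff (n : ℕ) :
    ∃ x ∈ allCorrelators n, (2 ^ n - 2) / 2 ^ n < bellExpression (nandCoeff n) x := by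
  refine ⟨1 - Pi.single 1 1, fun s => ?_, ?_⟩
  · rcases eq_or_ne s 1 with rfl | hs
    · simp
    · simp [hs]
  · have hsum : ∑ s : Bits n, (1 - Pi.single 1 1 : Bits n → ℝ) s = 2 ^ n - 1 := by
      simp
    rw [bellExpression_nandCoeff, hsum, Pi.sub_apply, Pi.single_eq_same, Pi.one_apply]
    gcongr ?_ / _
    norm_num

end LocalHiddenVariables

end Bell

end

theorem proposition3p3p2 (n : ℕ) (hn : 3 ≤ n) :
    Bell.IsNontrivialBellInequality (Bell.nandCoeff n) ((2 ^ n - 2) / 2 ^ n) ∧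
      ∀ p ∈ Bell.quantumCorrelators.{u} n,
        Bell.bellExpression (Bell.nandCoeff n) p ≤ (2 ^ n - 2) / 2 ^ n := by
  refine ⟨⟨Bell.isBellInequality_nandCoeff hn,
    Bell.exists_allCorrelators_lt_bellExpression_nandCoeff n⟩, ?_⟩
  rintro _ ⟨p, hp, rfl⟩
  exact hp.bellExpression_nandCoeff_le hn
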